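/- Consider the discrete-time linear system under attack, over a finite horizon $T\ge 0$, $$x_{k+1}=Ax_k+Bu_k+B^au^a_k+w_k,\qquad y_k=Cx_k+D^ad^a_k+v_k,$$ with $x_k\in\mathbb{R}^n$, $u_k\in\mathbb{R}^p$, $y_k\in\mathbb{R}^m$, $u^a_k\in\mathbb{R}^{p'}$, $d^a_k\in\mathbb{R}^{m'}$. Here $x_0\sim\mathcal N(\hat x_{0|-1},P_{0|-1})$, the $w_k\sim\mathcal N(0,Q)$ are IID, the $v_k\sim\mathcal N(0,R)$ are IID, and $x_0$, $(w_k)$, $(v_k)$ are independent ($P_{0|-1},Q,R$ positive semidefinite). The matrix $D^a$ selects $m'$ distinct attacked sensors $\gamma_1,\dots,\gamma_{m'}$: $D^a_{ij}=1$ if $i=\gamma_j$ and $0$ otherwise. The defender uses measurable functions $u_k=\mathcal U_k(y_{0:k},u_{0:k-1})$, which may depend on the model. The adversary has the information $\mathcal I^a_k=\{u^a_{0:k-1},d^a_{0:k},u^{pu}_{0:k-1},y^{pu}_{0:k},\theta\}$, where $u^{pu}_k$ is a fixed set of coordinates of $u_k$, $y^{pu}_k$ is a fixed set of coordinates of the sensor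 reading $Cx_k+v_k$ before its modification, and $\theta$ is the adversary's prior knowledge, an arbitrary (possibly constant) random element of a measurable space. The adversary uses measurable functions $u^a_k=\mathcal U^a_k(\mathcal I^a_k)$ and $d^a_k=\mathcal D^a_k(\mathcal I^a_{k-1},y^{pu}_k)$, where $\mathcal I^a_{-1}=\{\theta\}$. Normal operation means $u^a_k=0$, $d^a_k=0$ for all $k$, with the same model and the same defender strategy. Let $\hat x_{k|k-1}$ and $P_{k|k-1}$ be the Kalman filter quantities, started at $\hat x_{0|-1}$, $P_{0|-1}$: $$K_k=P_{k|k-1}C^T(CP_{k|k-1}C^T+R)^{-1},\qquad P_{k+1|k}=AP_{k|k-1}A^T+Q-AK_kCP_{k|k-1}A^T,$$ $$\hat x_{k|k}=(I-K_kC)\hat x_{k|k-1}+K_ky_k,\qquad \hat x_{k+1|k}=A\hat x_{k|k}+Bu_k,$$ and let $z_k=(CP_{k|k-1}C^T+R)^{-1/2}(y_k-C\hat x_{k|k-1})$ be the normalized residue. Assume that $CP_{k|k-1}C^T+R$ is positive definite for $0\le k\le T$. Write $\mathbb D^a_{\xi}$ and $\mathbb D^0_{\xi}$ for the law of $\xi$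 under attack and under normal operation, and let $D_{KL}\in[0,\infty]$ be the Kullback–Leibler divergence of probability measures. Define the information flow $$IF_T=\frac1{T+1}D_{KL}\big(\mathbb D^a_{y_{0:T}}\,\|\,\mathbb D^0_{y_{0:T}}\big).$$ Then $$IF_T\ \ge\ \frac1{T+1}\sum_{k=0}^{T}D_{KL}\big(\mathbb D^a_{z_k}\,\|\,\mathbb D^0_{z_k}\big),$$ and the gap consists of mutual-information terms: in $[0,\infty]$, $$IF_T=\frac1{T+1}\sum_{k=0}^{T}D_{KL}\big(\mathbb D^a_{z_k}\,\|\,\mathbb D^0_{z_k}\big)+\frac1{T+1}\sum_{k=0}^{T}I(z_k;z_{0:k-1}),$$ where $I(z_k;z_{0:k-1})=D_{KL}\big(\mathbb D^a_{(z_k,z_{0:k-1})}\,\|\,\mathbb D^a_{z_k}\otimes\mathbb D^a_{z_{0:k-1}}\big)\ge 0$ is the mutual information under attack (and is $0$ for $k=0$). -/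

import Mathlib

open MeasureTheory ProbabilityTheory InformationTheory Matrix
open scoped ENNReal MatrixOrder

noncomputable section

namespace CPS

/-- Euclidean space `ℝᵈ`. -/
abbrev Vec (d : ℕ) := EuclideanSpace ℝ (Fin d)

/-- The model `(A, B, C, Q, R, x̂_{0|-1}, P_{0|-1})` of a discrete-time linear control system with
state in `ℝⁿ`, control input in `ℝᵖ` and output in `ℝᵐ`. -/
structure Model (n p m : ℕ) where
  A : Matrix (Fin n) (Fin n) ℝ
  B : Matrix (Fin n) (Fin p) ℝ
  C : Matrix (Fin m) (Fin n) ℝ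
  /-- process noise covariance -/
  Q : Matrix (Fin n) (Fin n) ℝ
  /-- measurement noise covariance -/
  R : Matrix (Fin m) (Fin m) ℝ
  /-- prior mean of the initial state -/
  xhat0 : Vec n
  /-- prior covariance of the initial state -/
  P0 : Matrix (Fin n) (Fin n) ℝ
  hQ : Q.PosSemidef
  hR : R.PosSemidef
  hP0 : P0.PosSemidef

/-- What the adversary can touch and see: the input matrix `Ba`, the `m'` distinct attacked
sensors `γ 0, …, γ (m' - 1)`, and the coordinates of the control inputs and of the sensor readings
that are public. -/
structure AttackSurface (n p m p' m' : ℕ) where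
  Ba : Matrix (Fin n) (Fin p') ℝ
  γ : Fin m' ↪ Fin m
  pubU : Finset (Fin p)
  pubY : Finset (Fin m)

variable {n p m p' m' : ℕ} {Θ : Type*} [MeasurableSpace Θ]

/-- The matrix `Dᵃ` with `Dᵃ i j = 1` if `i = γ j` and `0` otherwise. -/
def AttackSurface.Da (S : AttackSurface n p m p' m') : Matrix (Fin m) (Fin m') ℝ :=
  Matrix.of fun i j => if i = S.γ j then 1 else 0

/-- The defender's information at time `k`: the pair `(y_{0:k}, u_{0:k-1})`. -/
abbrev DefenderInfo (p m k : ℕ) := (Fin (k + 1) → Vec m) × (Fin k → Vec p)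

/-- A defender control strategy: deterministic measurable functions `𝒰_k` of the information at
time `k`. They may depend on the model in any way, since the model is fixed. -/
structure DefenderStrategy (p m : ℕ) where
  U : ∀ k : ℕ, DefenderInfo p m k → Vec p
  measurable_U : ∀ k, Measurable (U k)

/-- The adversary's information `ℐᵃ_{j-1}`, that is, at the moment when `j` measurements have been
made: `(uᵃ_{0:j-2}, dᵃ_{0:j-1}, uᵖᵘ_{0:j-2}, yᵖᵘ_{0:j-1})` and the prior knowledge, an element
of `Θ`. For `j = 0` only the prior knowledge is left. -/
abbrev AdversaryInfo (S : AttackSurface n p m p' m') (Θ : Type*) (j : ℕ) :=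
  (Fin (j - 1) → Vec p') × (Fin j → Vec m') × (Fin (j - 1) → S.pubU → ℝ) ×
    (Fin j → S.pubY → ℝ) × Θ

/-- An attack strategy: deterministic measurable functions `𝒰ᵃ_k` of `ℐᵃ_k` and `𝒟ᵃ_k` of
`(ℐᵃ_{k-1}, yᵖᵘ_k)`. -/
structure AttackStrategy (S : AttackSurface n p m p' m') (Θ : Type*) [MeasurableSpace Θ] where
  Ua : ∀ k : ℕ, AdversaryInfo S Θ (k + 1) → Vec p'
  measurable_Ua : ∀ k, Measurable (Ua k)
  Da : ∀ k : ℕ, AdversaryInfo S Θ k × (S.pubY → ℝ) → Vec m'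
  measurable_Da : ∀ k, Measurable (Da k)

/-- Normal operation: all attack inputs vanish. -/
instance (S : AttackSurface n p m p' m') : Zero (AttackStrategy S Θ) where
  zero :=
    { Ua := fun _ _ => 0
      measurable_Ua := fun _ => measurable_const
      Da := fun _ _ => 0
      measurable_Da := fun _ => measurable_const }

/-- A record of the signals of the closed loop: state `x`, uncorrupted sensor reading
`s_k = C x_k + v_k`, received output `y`, control input `u`, attack inputs `ua` and `d`. -/
structure Signals (n p m p' m' : ℕ) where
  x : ℕ → Vec n
  s : ℕ → Vec m
  y : ℕ → Vec m
  u : ℕ → Vec p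
  ua : ℕ → Vec p'
  d : ℕ → Vec m'

/-- The adversary's information `ℐᵃ_{j-1}` read off a record of the signals. The public readings
are those the sensors send, before the adversary's modification. -/
def Signals.adversaryInfo (S : AttackSurface n p m p' m') (σ : Signals n p m p' m') (θ : Θ)
    (j : ℕ) : AdversaryInfo S Θ j :=
  (fun i => σ.ua i, fun i => σ.d i, fun i c => σ.u i c.1, fun i c => σ.s i c.1, θ)

/-- Time step `k` of the closed loop, with noise values `wk`, `vk`. The record `σ` holds `x_k` and
all signals before time `k`; the entries at time `k` and `x_{k+1}` are filled in. -/
def step (M : Model n p m) (S : AttackSurface n p m p' m') (𝒰 : DefenderStrategy p m)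
    (𝒜 : AttackStrategy S Θ) (θ : Θ) (k : ℕ) (wk : Vec n) (vk : Vec m)
    (σ : Signals n p m p' m') : Signals n p m p' m' :=
  let xk := σ.x k
  let sk := M.C.toEuclideanLin xk + vk
  let dk := 𝒜.Da k (σ.adversaryInfo S θ k, fun c => sk c.1)
  let yk := M.C.toEuclideanLin xk + S.Da.toEuclideanLin dk + vk
  let σ₁ := { σ with
    s := Function.update σ.s k sk
    d := Function.update σ.d k dk
    y := Function.update σ.y k yk }
  let uk := 𝒰.U k (fun i => σ₁.y i, fun i => σ₁.u i)
  let uak := 𝒜.Ua k (σ₁.adversaryInfo S θ (k + 1))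
  { σ₁ with
    u := Function.update σ.u k uk
    ua := Function.update σ.ua k uak
    x := Function.update σ.x (k + 1) (M.A.toEuclideanLin xk + M.B.toEuclideanLin uk
      + S.Ba.toEuclideanLin uak + wk) }

/-- The record after `k` time steps, from initial state `x₀` and noise values `w`, `v`. -/
def run (M : Model n p m) (S : AttackSurface n p m p' m') (𝒰 : DefenderStrategy p m)
    (𝒜 : AttackStrategy S Θ) (θ : Θ) (x₀ : Vec n) (w : ℕ → Vec n) (v : ℕ → Vec m) :
    ℕ → Signals n p m p' m'
  | 0 => { x := fun _ => x₀, s := 0, y := 0, u := 0, ua := 0, d := 0 }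
  | k + 1 => step M S 𝒰 𝒜 θ k (w k) (v k) (run M S 𝒰 𝒜 θ x₀ w v k)

/-- `y_k` -/
def output (M : Model n p m) (S : AttackSurface n p m p' m') (𝒰 : DefenderStrategy p m)
    (𝒜 : AttackStrategy S Θ) (θ : Θ) (x₀ : Vec n) (w : ℕ → Vec n) (v : ℕ → Vec m)
    (k : ℕ) : Vec m :=
  (run M S 𝒰 𝒜 θ x₀ w v (k + 1)).y k

/-- `u_k` -/
def control (M : Model n p m) (S : AttackSurface n p m p' m') (𝒰 : DefenderStrategy p m)
    (𝒜 : AttackStrategy S Θ) (θ : Θ) (x₀ : Vec n) (w : ℕ → Vec n) (v : ℕ → Vec m)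
    (k : ℕ) : Vec p :=
  (run M S 𝒰 𝒜 θ x₀ w v (k + 1)).u k

namespace Model

variable (M : Model n p m)

/-- The Kalman gain `P Cᵀ (C P Cᵀ + R)⁻¹` for the prediction covariance `P`. -/
def gain (P : Matrix (Fin n) (Fin n) ℝ) : Matrix (Fin n) (Fin m) ℝ :=
  P * M.Cᵀ * (M.C * P * M.Cᵀ + M.R)⁻¹

/-- `P_{k|k-1}` -/
def predCov : ℕ → Matrix (Fin n) (Fin n) ℝ
  | 0 => M.P0
  | k + 1 =>
    M.A * predCov k * M.Aᵀ + M.Q - M.A * M.gain (predCov k) * M.C * predCov k * M.Aᵀ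

/-- `C P_{k|k-1} Cᵀ + R` -/
def innovCov (k : ℕ) : Matrix (Fin m) (Fin m) ℝ :=
  M.C * M.predCov k * M.Cᵀ + M.R

/-- The Kalman prediction `x̂_{k|k-1}` from outputs `y` and control inputs `u`:
`x̂_{k|k} = (I - K_k C) x̂_{k|k-1} + K_k y_k` and `x̂_{k+1|k} = A x̂_{k|k} + B u_k`. -/
def prediction (y : ℕ → Vec m) (u : ℕ → Vec p) : ℕ → Vec n
  | 0 => M.xhat0
  | k + 1 =>
    M.A.toEuclideanLin
        ((1 - M.gain (M.predCov k) * M.C).toEuclideanLin (prediction y u k)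
          + (M.gain (M.predCov k)).toEuclideanLin (y k))
      + M.B.toEuclideanLin (u k)

/-- The normalized residue `(C P_{k|k-1} Cᵀ + R)^{-1/2} (y_k - C x̂_{k|k-1})`. -/
def normalizedResidue (y : ℕ → Vec m) (u : ℕ → Vec p) (k : ℕ) : Vec m :=
  ((CFC.sqrt (M.innovCov k))⁻¹).toEuclideanLin (y k - M.C.toEuclideanLin (M.prediction y u k))

end Model

/-- The residue `z_k` of the closed loop. -/
def residue (M : Model n p m) (S : AttackSurface n p m p' m') (𝒰 : DefenderStrategy p m)
    (𝒜 : AttackStrategy S Θ) (θ : Θ) (x₀ : Vec n) (w : ℕ → Vec n) (v : ℕ → Vec m)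
    (k : ℕ) : Vec m :=
  M.normalizedResidue (output M S 𝒰 𝒜 θ x₀ w v) (control M S 𝒰 𝒜 θ x₀ w v) k

variable {Ω : Type*} [MeasurableSpace Ω]

/-- The initial state is `𝒩(x̂_{0|-1}, P_{0|-1})`, `w` is IID `𝒩(0, Q)`, `v` is IID `𝒩(0, R)`, and
the initial state, `w` and `v` are independent. -/
structure IsNoise (M : Model n p m) (x₀ : Ω → Vec n) (w : ℕ → Ω → Vec n) (v : ℕ → Ω → Vec m)
    (μ : Measure Ω) : Prop where
  law_x₀ : HasLaw x₀ (multivariateGaussian M.xhat0 M.P0) μ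
  law_w : ∀ k, HasLaw (w k) (multivariateGaussian 0 M.Q) μ
  law_v : ∀ k, HasLaw (v k) (multivariateGaussian 0 M.R) μ
  indep_w : iIndepFun w μ
  indep_v : iIndepFun v μ
  indep_w_v : IndepFun (fun ω k => w k ω) (fun ω k => v k ω) μ
  indep_x₀ : IndepFun x₀ (fun ω => (fun k => w k ω, fun k => v k ω)) μ

/-- The law of `y_{0:T}`. -/
def outputLaw (M : Model n p m) (S : AttackSurface n p m p' m') (𝒰 : DefenderStrategy p m)
    (𝒜 : AttackStrategy S Θ) (θ : Ω → Θ) (x₀ : Ω → Vec n) (w : ℕ → Ω → Vec n)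
    (v : ℕ → Ω → Vec m) (μ : Measure Ω) (T : ℕ) : Measure (Fin (T + 1) → Vec m) :=
  μ.map fun ω i => output M S 𝒰 𝒜 (θ ω) (x₀ ω) (fun k => w k ω) (fun k => v k ω) i

/-- The random variable `z_k`. -/
def residueVar (M : Model n p m) (S : AttackSurface n p m p' m') (𝒰 : DefenderStrategy p m)
    (𝒜 : AttackStrategy S Θ) (θ : Ω → Θ) (x₀ : Ω → Vec n) (w : ℕ → Ω → Vec n)
    (v : ℕ → Ω → Vec m) (k : ℕ) (ω : Ω) : Vec m :=
  residue M S 𝒰 𝒜 (θ ω) (x₀ ω) (fun k => w k ω) (fun k => v k ω) k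

/-- The information flow `IF_T`, the KL divergence of the law of `y_{0:T}` under attack from the
one under normal operation, divided by `T + 1`. -/
def infoFlow (M : Model n p m) (S : AttackSurface n p m p' m') (𝒰 : DefenderStrategy p m)
    (𝒜 : AttackStrategy S Θ) (θ : Ω → Θ) (x₀ : Ω → Vec n) (w : ℕ → Ω → Vec n)
    (v : ℕ → Ω → Vec m) (μ : Measure Ω) (T : ℕ) : ℝ≥0∞ :=
  klDiv (outputLaw M S 𝒰 𝒜 θ x₀ w v μ T) (outputLaw M S 𝒰 0 θ x₀ w v μ T) / (T + 1)

/-- The KL divergence of the law of the single residue `z_k` under attack from the one under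
normal operation. -/
def residueDiv (M : Model n p m) (S : AttackSurface n p m p' m') (𝒰 : DefenderStrategy p m)
    (𝒜 : AttackStrategy S Θ) (θ : Ω → Θ) (x₀ : Ω → Vec n) (w : ℕ → Ω → Vec n)
    (v : ℕ → Ω → Vec m) (μ : Measure Ω) (k : ℕ) : ℝ≥0∞ :=
  klDiv (μ.map (residueVar M S 𝒰 𝒜 θ x₀ w v k)) (μ.map (residueVar M S 𝒰 0 θ x₀ w v k))

/-- Mutual information of two random variables. -/
def mutualInfo {α β : Type*} [MeasurableSpace α] [MeasurableSpace β] (X : Ω → α) (Y : Ω → β)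
    (μ : Measure Ω) : ℝ≥0∞ :=
  klDiv (μ.map fun ω => (X ω, Y ω)) ((μ.map X).prod (μ.map Y))

end CPS

end

/-! Outputs and residues carry the same information. Once the controls answer the outputs through
`𝒰`, the prediction at time `k` is a measurable function of the outputs before `k`. Hence outputs
determine residues. Conversely, positive definiteness of the innovation covariance lets one solve
successively for `y_k` from `z_k` and the earlier outputs. These two maps depend on the model and on
`𝒰` but not on the attack, so data processing in both directions gives equal divergences
(`klDiv_map_of_leftInverse`, `klDiv_outputLaw_eq`).

Under normal operation the residues are independent. The control input cancels in the prediction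
error, which is therefore affine in the Gaussian noise even when `𝒰` is nonlinear. The Kalman gain
makes the filtered error uncorrelated with the current innovation; for jointly Gaussian vectors this
is independence, and it propagates in time (`kalman_step`, `IsNoise.predErrorVar_law`).

The divergence of a joint law from a product is the sum of the marginal divergences and the mutual
information (`klDiv_prod_eq_mutual_add`). Splitting off the last residue repeatedly gives the
equality (`klDiv_prefix_eq_sum`), and the inequality follows because mutual information is
nonnegative. Of the residues under attack only measurability is used; under normal operation
independence suffices, and their exact law is never needed. -/

noncomputable section

namespace CPS

/-! ### Kullback–Leibler divergence: invariance and chain rule -/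

section Divergence

variable {α β : Type*} [MeasurableSpace α] [MeasurableSpace β]

/-- The divergence does not change under a map that is invertible on the supports. -/
lemma klDiv_map_of_leftInverse {Ω : Type*} [MeasurableSpace Ω] (μ ν : Measure Ω)
    [IsFiniteMeasure μ] [IsFiniteMeasure ν] {X X' : Ω → α} {Y Y' : Ω → β}
    (hX : AEMeasurable X μ) (hX' : AEMeasurable X' ν) {f : α → β} {g : β → α}
    (hf : Measurable f) (hg : Measurable g) (hY : ∀ ω, Y ω = f (X ω)) (hY' : ∀ ω, Y' ω = f (X' ω))
    (hgf : ∀ ω, X ω = g (Y ω)) (hgf' : ∀ ω, X' ω = g (Y' ω)) :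
    klDiv (μ.map X) (ν.map X') = klDiv (μ.map Y) (ν.map Y') := by
  have e1 : (μ.map X).map f = μ.map Y := by
    rw [AEMeasurable.map_map_of_aemeasurable hf.aemeasurable hX]
    congr 1; ext1 ω; exact (hY ω).symm
  have e2 : (ν.map X').map f = ν.map Y' := by
    rw [AEMeasurable.map_map_of_aemeasurable hf.aemeasurable hX']
    congr 1; ext1 ω; exact (hY' ω).symm
  have hYm : AEMeasurable Y μ := (hf.comp_aemeasurable hX).congr (.of_forall fun ω => (hY ω).symm)
  have hYm' : AEMeasurable Y' ν :=
    (hf.comp_aemeasurable hX').congr (.of_forall fun ω => (hY' ω).symm)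
  have e3 : (μ.map Y).map g = μ.map X := by
    rw [AEMeasurable.map_map_of_aemeasurable hg.aemeasurable hYm]
    congr 1; ext1 ω; exact (hgf ω).symm
  have e4 : (ν.map Y').map g = ν.map X' := by
    rw [AEMeasurable.map_map_of_aemeasurable hg.aemeasurable hYm']
    congr 1; ext1 ω; exact (hgf' ω).symm
  apply le_antisymm
  · conv_lhs => rw [← e3, ← e4]
    exact klDiv_map_le _ _ hg
  · conv_lhs => rw [← e1, ← e2]
    exact klDiv_map_le _ _ hf

lemma klDiv_map_measurableEquiv (μ ν : Measure α) [IsFiniteMeasure μ] [IsFiniteMeasure ν]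
    (e : α ≃ᵐ β) : klDiv (μ.map e) (ν.map e) = klDiv μ ν := by
  have := klDiv_map_of_leftInverse μ ν (X := id) (X' := id) (Y := e) (Y' := e) aemeasurable_id
    aemeasurable_id e.measurable e.symm.measurable (by simp) (by simp) (by simp) (by simp)
  simpa using this.symm

/-- Chain rule for `ρ` disintegrated over its first marginal, against the constant kernel `b`. The
conditional term reappears as a divergence from `ρ.fst.prod b`. -/
lemma klDiv_prod_eq_fst_add [StandardBorelSpace β] [Nonempty β] (ρ : Measure (α × β))
    [IsProbabilityMeasure ρ] (a : Measure α) (b : Measure β) [IsProbabilityMeasure a]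
    [IsProbabilityMeasure b] :
    klDiv ρ (a.prod b) = klDiv ρ.fst a + klDiv ρ (ρ.fst.prod b) := by
  have h := klDiv_compProd_eq_add ρ.fst a ρ.condKernel (Kernel.const α b)
  rwa [Measure.compProd_const, Measure.compProd_const, ρ.disintegrate] at h

/-- The divergence of a joint law from a product is the mutual information plus the divergences of
the marginals. -/
lemma klDiv_prod_eq_mutual_add [StandardBorelSpace α] [Nonempty α] [StandardBorelSpace β]
    [Nonempty β] (ρ : Measure (α × β)) [IsProbabilityMeasure ρ] (a : Measure α) (b : Measure β)
    [IsProbabilityMeasure a] [IsProbabilityMeasure b] :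
    klDiv ρ (a.prod b) = klDiv ρ.fst a + klDiv ρ.snd b + klDiv ρ (ρ.fst.prod ρ.snd) := by
  have swap (c : Measure α) (d : Measure β) [IsProbabilityMeasure c] [IsProbabilityMeasure d] :
      klDiv (ρ.map Prod.swap) (d.prod c) = klDiv ρ (c.prod d) := by
    rw [← Measure.prod_swap]
    exact klDiv_map_measurableEquiv ρ (c.prod d) MeasurableEquiv.prodComm
  have : IsProbabilityMeasure (ρ.map Prod.swap) :=
    Measure.isProbabilityMeasure_map measurable_swap.aemeasurable
  -- The term left over by the first chain rule is `klDiv ρ (ρ.fst.prod b)`. After swapping factors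
  -- the same rule splits off the second marginal and leaves the mutual information. Nothing is
  -- subtracted, so infinite values are harmless.
  have h := klDiv_prod_eq_fst_add (ρ.map Prod.swap) b ρ.fst
  rw [Measure.fst_map_swap, swap, swap] at h
  rw [klDiv_prod_eq_fst_add, h, add_assoc]

end Divergence

/-! ### Regrouping independent random variables -/

section Independence

variable {Ω α β γ : Type*} [MeasurableSpace Ω] [MeasurableSpace α] [MeasurableSpace β]
  [MeasurableSpace γ] {μ : Measure Ω} [IsProbabilityMeasure μ]

/-- The hypotheses make the joint law the product of the three marginals, and associativity of the
product measure moves the bracket. -/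
lemma indepFun_prodMk_of_indepFun {X : Ω → α} {Y : Ω → β} {Z : Ω → γ} (hX : AEMeasurable X μ)
    (hY : AEMeasurable Y μ) (hZ : AEMeasurable Z μ) (h : IndepFun X (fun ω => (Y ω, Z ω)) μ)
    (hYZ : IndepFun Y Z μ) : IndepFun (fun ω => (X ω, Y ω)) Z μ := by
  have hXY : IndepFun X Y μ := h.comp measurable_id measurable_fst
  rw [indepFun_iff_map_prod_eq_prod_map_map (hX.prodMk hY) hZ, hXY.map_prod_eq_prod_map_map hX hY]
  have h3 := h.map_prod_eq_prod_map_map hX (hY.prodMk hZ)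
  rw [hYZ.map_prod_eq_prod_map_map hY hZ] at h3
  have := Measure.isProbabilityMeasure_map (μ := μ) hX
  have := Measure.isProbabilityMeasure_map (μ := μ) hY
  have := Measure.isProbabilityMeasure_map (μ := μ) hZ
  apply MeasurableEquiv.prodAssoc.map_measurableEquiv_injective
  rw [Measure.prodAssoc_prod, ← h3, AEMeasurable.map_map_of_aemeasurable
    MeasurableEquiv.prodAssoc.measurable.aemeasurable ((hX.prodMk hY).prodMk hZ)]
  rfl

/-- Two independent pairs with independent components can be regrouped. -/
lemma indepFun_prodMk_prodMk_of_indepFun {δ : Type*} [MeasurableSpace δ] {X : Ω → α} {Y : Ω → β}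
    {X' : Ω → γ} {Y' : Ω → δ} (hX : AEMeasurable X μ) (hY : AEMeasurable Y μ)
    (hX' : AEMeasurable X' μ) (hY' : AEMeasurable Y' μ)
    (h : IndepFun (fun ω => (X ω, Y ω)) (fun ω => (X' ω, Y' ω)) μ) (hXY : IndepFun X Y μ)
    (hXY' : IndepFun X' Y' μ) :
    IndepFun (fun ω => (X ω, X' ω)) (fun ω => (Y ω, Y' ω)) μ := by
  have h1 : IndepFun (fun ω => ((X ω, Y ω), X' ω)) Y' μ :=
    indepFun_prodMk_of_indepFun (hX.prodMk hY) hX' hY' h hXY'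
  have h2 : IndepFun (fun ω => (X' ω, X ω)) Y μ :=
    indepFun_prodMk_of_indepFun hX' hX hY (h.symm.comp measurable_fst measurable_id) hXY
  have h3 : IndepFun (fun ω => (Y' ω, Y ω)) (fun ω => (X ω, X' ω)) μ := by
    refine indepFun_prodMk_of_indepFun hY' hY (hX.prodMk hX') ?_
      (h2.symm.comp measurable_id measurable_swap)
    exact h1.symm.comp (φ := id) (ψ := fun q : (α × β) × γ => (q.1.2, (q.1.1, q.2)))
      measurable_id (by fun_prop)
  exact h3.symm.comp measurable_id measurable_swap

end Independence

lemma aemeasurable_prefix {Ω α : Type*} [MeasurableSpace Ω] [MeasurableSpace α] {μ : Measure Ω}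
    {X : ℕ → Ω → α} (hX : ∀ k, AEMeasurable (X k) μ) (k : ℕ) :
    AEMeasurable (fun ω (i : Fin k) => X i ω) μ :=
  aemeasurable_pi_lambda _ fun i => hX i

lemma indepFun_prefix {Ω α : Type*} [MeasurableSpace Ω] [MeasurableSpace α] {μ : Measure Ω}
    {X : ℕ → Ω → α} (h : iIndepFun X μ) (hX : ∀ k, AEMeasurable (X k) μ)
    (k : ℕ) : IndepFun (fun ω (i : Fin k) => X i ω) (X k) μ := by
  have := h.indepFun_finset₀ (Finset.range k) {k} (by simp) hX
  have hφ : Measurable fun (q : Finset.range k → α) (i : Fin k) => q ⟨i, by simp⟩ :=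
    measurable_pi_lambda _ fun _ => measurable_pi_apply _
  have hψ : Measurable fun q : ({k} : Finset ℕ) → α => q ⟨k, by simp⟩ := measurable_pi_apply _
  exact this.comp hφ hψ

variable {n p m p' m' : ℕ} {Θ : Type*} [MeasurableSpace Θ]

lemma measurable_toEuclideanLin {a b : ℕ} (A : Matrix (Fin a) (Fin b) ℝ) :
    Measurable (A.toEuclideanLin : Vec b → Vec a) :=
  (LinearMap.continuous_of_finiteDimensional _).measurable

/-! ### The closed loop: causality and normal operation -/

section Run

variable (M : Model n p m) (S : AttackSurface n p m p' m') (𝒰 : DefenderStrategy p m)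
  (𝒜 : AttackStrategy S Θ) (θ : Θ) (x₀ : Vec n) (w : ℕ → Vec n) (v : ℕ → Vec m)

lemma run_y_eq_output {j k : ℕ} (h : j < k) :
    (run M S 𝒰 𝒜 θ x₀ w v k).y j = output M S 𝒰 𝒜 θ x₀ w v j := by
  induction k, h using Nat.le_induction with
  | base => rfl
  | succ k hk ih => exact (Function.update_of_ne (by omega) _ _).trans ih

lemma run_u_eq_control {j k : ℕ} (h : j < k) :
    (run M S 𝒰 𝒜 θ x₀ w v k).u j = control M S 𝒰 𝒜 θ x₀ w v j := by
  induction k, h using Nat.le_induction with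
  | base => rfl
  | succ k hk ih => exact (Function.update_of_ne (by omega) _ _).trans ih

/-- The control inputs `u` answer the outputs `y` according to the strategy `𝒰`. -/
def DefenderStrategy.IsResponse (𝒰 : DefenderStrategy p m) (y : ℕ → Vec m) (u : ℕ → Vec p) :
    Prop :=
  ∀ k, u k = 𝒰.U k (fun i => y i, fun i => u i)

/-- An attack affects the controls only through the outputs the defender receives, so the relation
is the same for every `𝒜`. This is why one pair of maps between outputs and residues serves both
laws. -/
lemma isResponse_control :
    𝒰.IsResponse (output M S 𝒰 𝒜 θ x₀ w v) (control M S 𝒰 𝒜 θ x₀ w v) := by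
  intro k
  -- When `u_k` is computed the record already holds `y_k` but only controls before `k`, whence the
  -- different numbers of steps in the two arguments.
  have h : control M S 𝒰 𝒜 θ x₀ w v k
      = 𝒰.U k (fun i => (run M S 𝒰 𝒜 θ x₀ w v (k + 1)).y i,
          fun i => (run M S 𝒰 𝒜 θ x₀ w v k).u i) := Function.update_self _ _ _
  rw [h]
  congr 2
  · ext1 i
    exact run_y_eq_output M S 𝒰 𝒜 θ x₀ w v i.2
  · ext1 i
    exact run_u_eq_control M S 𝒰 𝒜 θ x₀ w v i.2

lemma output_zero (k : ℕ) :
    output M S 𝒰 0 θ x₀ w v k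
      = M.C.toEuclideanLin ((run M S 𝒰 0 θ x₀ w v k).x k) + v k := by
  have h : output M S 𝒰 0 θ x₀ w v k = M.C.toEuclideanLin ((run M S 𝒰 0 θ x₀ w v k).x k)
      + S.Da.toEuclideanLin (0 : Vec m') + v k := Function.update_self _ _ _
  rw [h, map_zero, add_zero]

lemma run_zero_x_succ (k : ℕ) :
    (run M S 𝒰 0 θ x₀ w v (k + 1)).x (k + 1)
      = M.A.toEuclideanLin ((run M S 𝒰 0 θ x₀ w v k).x k)
        + M.B.toEuclideanLin (control M S 𝒰 0 θ x₀ w v k) + w k := by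
  have h : (run M S 𝒰 0 θ x₀ w v (k + 1)).x (k + 1)
      = M.A.toEuclideanLin ((run M S 𝒰 0 θ x₀ w v k).x k)
        + M.B.toEuclideanLin (𝒰.U k (fun i => (run M S 𝒰 0 θ x₀ w v (k + 1)).y i,
          fun i => (run M S 𝒰 0 θ x₀ w v k).u i))
        + S.Ba.toEuclideanLin (0 : Vec p') + w k := Function.update_self _ _ _
  have h' : control M S 𝒰 0 θ x₀ w v k
      = 𝒰.U k (fun i => (run M S 𝒰 0 θ x₀ w v (k + 1)).y i,
          fun i => (run M S 𝒰 0 θ x₀ w v k).u i) := Function.update_self _ _ _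
  rw [h, h', map_zero, add_zero]

end Run

/-! ### Measurability of the signals in the noise and the prior knowledge -/

section Measurability

variable {Ξ : Type*} [MeasurableSpace Ξ]

/-- All signals of the record depend measurably on a parameter. -/
structure MeasurableSignals (σ : Ξ → Signals n p m p' m') : Prop where
  x : ∀ j, Measurable fun q => (σ q).x j
  s : ∀ j, Measurable fun q => (σ q).s j
  y : ∀ j, Measurable fun q => (σ q).y j
  u : ∀ j, Measurable fun q => (σ q).u j
  ua : ∀ j, Measurable fun q => (σ q).ua j
  d : ∀ j, Measurable fun q => (σ q).d j

lemma measurable_update_apply {α : Type*} [MeasurableSpace α] {f : Ξ → ℕ → α} {g : Ξ → α}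
    (hf : ∀ j, Measurable fun q => f q j) (hg : Measurable g) (k j : ℕ) :
    Measurable fun q => Function.update (f q) k (g q) j := by
  by_cases h : j = k
  · subst h; simpa using hg
  · simpa [Function.update_of_ne h] using hf j

lemma measurable_adversaryInfo (S : AttackSurface n p m p' m') {σ : Ξ → Signals n p m p' m'}
    {θ : Ξ → Θ} (hua : ∀ j, Measurable fun q => (σ q).ua j)
    (hd : ∀ j, Measurable fun q => (σ q).d j) (hu : ∀ j, Measurable fun q => (σ q).u j)
    (hs : ∀ j, Measurable fun q => (σ q).s j) (hθ : Measurable θ) (j : ℕ) :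
    Measurable fun q => (σ q).adversaryInfo S (θ q) j := by
  refine Measurable.prodMk (measurable_pi_lambda (fun q (i : Fin (j - 1)) => (σ q).ua i)
    fun i => hua i) (Measurable.prodMk (measurable_pi_lambda (fun q (i : Fin j) => (σ q).d i)
      fun i => hd i) (Measurable.prodMk ?_ (Measurable.prodMk ?_ hθ)))
  · refine measurable_pi_lambda _ fun i => measurable_pi_lambda _ fun c => ?_
    have := hu i
    fun_prop
  · refine measurable_pi_lambda _ fun i => measurable_pi_lambda _ fun c => ?_
    have := hs i
    fun_prop

lemma MeasurableSignals.step (M : Model n p m) (S : AttackSurface n p m p' m')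
    (𝒰 : DefenderStrategy p m) (𝒜 : AttackStrategy S Θ) {θ : Ξ → Θ} (hθ : Measurable θ) (k : ℕ)
    {w : Ξ → Vec n} (hw : Measurable w) {v : Ξ → Vec m} (hv : Measurable v)
    {σ : Ξ → Signals n p m p' m'} (h : MeasurableSignals σ) :
    MeasurableSignals fun q => CPS.step M S 𝒰 𝒜 (θ q) k (w q) (v q) (σ q) := by
  have hCx : Measurable fun q => M.C.toEuclideanLin ((σ q).x k) :=
    (measurable_toEuclideanLin _).comp (h.x k)
  have hsk : Measurable fun q => M.C.toEuclideanLin ((σ q).x k) + v q := hCx.add hv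
  have hdk : Measurable fun q => 𝒜.Da k ((σ q).adversaryInfo S (θ q) k,
      fun c => (M.C.toEuclideanLin ((σ q).x k) + v q) c.1) := by
    refine (𝒜.measurable_Da k).comp
      ((measurable_adversaryInfo S h.ua h.d h.u h.s hθ k).prodMk ?_)
    refine measurable_pi_lambda _ fun c => ?_
    fun_prop
  have hs := measurable_update_apply h.s hsk k
  have hd := measurable_update_apply h.d hdk k
  have hy := measurable_update_apply h.y
    ((hCx.add ((measurable_toEuclideanLin S.Da).comp hdk)).add hv) k
  have huk := (𝒰.measurable_U k).comp
    ((measurable_pi_lambda _ fun i : Fin (k + 1) => hy i).prodMk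
      (measurable_pi_lambda _ fun i : Fin k => h.u i))
  -- The adversary chooses its input after `s_k` and `d_k` are recorded, so the intermediate record
  -- of `step` has to be supplied.
  have huak := (𝒜.measurable_Ua k).comp (measurable_adversaryInfo S
    (σ := fun q => { σ q with
      s := Function.update (σ q).s k (M.C.toEuclideanLin ((σ q).x k) + v q)
      d := Function.update (σ q).d k (𝒜.Da k ((σ q).adversaryInfo S (θ q) k,
        fun c => (M.C.toEuclideanLin ((σ q).x k) + v q) c.1))
      y := Function.update (σ q).y k (M.C.toEuclideanLin ((σ q).x k)
        + S.Da.toEuclideanLin (𝒜.Da k ((σ q).adversaryInfo S (θ q) k,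
          fun c => (M.C.toEuclideanLin ((σ q).x k) + v q) c.1)) + v q) })
    h.ua hd h.u hs hθ (k + 1))
  exact
    { x := measurable_update_apply h.x (((((measurable_toEuclideanLin M.A).comp (h.x k)).add
        ((measurable_toEuclideanLin M.B).comp huk)).add
        ((measurable_toEuclideanLin S.Ba).comp huak)).add hw) (k + 1)
      s := hs
      y := hy
      u := measurable_update_apply h.u huk k
      ua := measurable_update_apply h.ua huak k
      d := hd }

lemma measurableSignals_run (M : Model n p m) (S : AttackSurface n p m p' m')
    (𝒰 : DefenderStrategy p m) (𝒜 : AttackStrategy S Θ) (k : ℕ) :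
    MeasurableSignals fun q : Θ × Vec n × (ℕ → Vec n) × (ℕ → Vec m) =>
      run M S 𝒰 𝒜 q.1 q.2.1 q.2.2.1 q.2.2.2 k := by
  induction k with
  | zero =>
    exact
      { x := fun _ => measurable_snd.fst
        s := fun _ => measurable_const
        y := fun _ => measurable_const
        u := fun _ => measurable_const
        ua := fun _ => measurable_const
        d := fun _ => measurable_const }
  | succ k ih =>
    exact ih.step M S 𝒰 𝒜 measurable_fst k ((measurable_pi_apply k).comp measurable_snd.snd.fst)
      ((measurable_pi_apply k).comp measurable_snd.snd.snd)

lemma measurable_output (M : Model n p m) (S : AttackSurface n p m p' m')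
    (𝒰 : DefenderStrategy p m) (𝒜 : AttackStrategy S Θ) (k : ℕ) :
    Measurable fun q : Θ × Vec n × (ℕ → Vec n) × (ℕ → Vec m) =>
      output M S 𝒰 𝒜 q.1 q.2.1 q.2.2.1 q.2.2.2 k := by
  unfold output
  exact (measurableSignals_run M S 𝒰 𝒜 (k + 1)).y k

end Measurability

lemma measurable_snoc {Ξ α : Type*} [MeasurableSpace Ξ] [MeasurableSpace α] {k : ℕ}
    {f : Ξ → Fin k → α} {g : Ξ → α} (hf : Measurable f) (hg : Measurable g) :
    Measurable fun q => Fin.snoc (α := fun _ => α) (f q) (g q) := by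
  refine measurable_pi_lambda _ fun i => ?_
  induction i using Fin.lastCases with
  | last => simpa using hg
  | cast i => simpa using measurable_pi_iff.1 hf i

/-! ### Outputs and residues determine each other -/

section Residues

variable (M : Model n p m) (𝒰 : DefenderStrategy p m)

/-- Past control inputs are a measurable function of past outputs. -/
lemma DefenderStrategy.exists_measurable_response (k : ℕ) :
    ∃ g : (Fin k → Vec m) → Fin k → Vec p, Measurable g ∧
      ∀ y u, 𝒰.IsResponse y u → (fun i : Fin k => u i) = g fun i => y i := by
  induction k with
  | zero => exact ⟨fun _ i => i.elim0, measurable_const, fun y u _ => Subsingleton.elim _ _⟩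
  | succ k ih =>
    obtain ⟨g, hg, h⟩ := ih
    refine ⟨fun y => Fin.snoc (α := fun _ => Vec p) (g fun i => y i.castSucc)
      (𝒰.U k (y, g fun i => y i.castSucc)), ?_, ?_⟩
    · have h1 : Measurable fun y : Fin (k + 1) → Vec m => g fun i => y i.castSucc :=
        hg.comp (measurable_pi_lambda _ fun i => measurable_pi_apply _)
      exact measurable_snoc h1 ((𝒰.measurable_U k).comp (measurable_id.prodMk h1))
    · intro y u hu
      ext1 i
      induction i using Fin.lastCases with
      | last =>
        have := h y u hu
        simp only [Fin.val_last, Fin.snoc_last, Fin.val_castSucc]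
        rw [hu k, this]
      | cast i => simpa using congrFun (h y u hu) i

/-- The Kalman prediction is a measurable function of past outputs. -/
lemma exists_measurable_prediction (k : ℕ) :
    ∃ g : (Fin k → Vec m) → Vec n, Measurable g ∧
      ∀ y u, 𝒰.IsResponse y u → M.prediction y u k = g fun i => y i := by
  induction k with
  | zero => exact ⟨fun _ => M.xhat0, measurable_const, fun y u _ => rfl⟩
  | succ k ih =>
    obtain ⟨g, hg, h⟩ := ih
    obtain ⟨c, hc, h'⟩ := 𝒰.exists_measurable_response (k + 1)
    refine ⟨fun y => M.A.toEuclideanLin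
        ((1 - M.gain (M.predCov k) * M.C).toEuclideanLin (g fun i => y i.castSucc)
          + (M.gain (M.predCov k)).toEuclideanLin (y (Fin.last k)))
      + M.B.toEuclideanLin (c y (Fin.last k)), ?_, ?_⟩
    · refine Measurable.add ?_ ?_
      · refine (measurable_toEuclideanLin _).comp (Measurable.add ?_ ?_)
        · exact (measurable_toEuclideanLin _).comp
            (hg.comp (measurable_pi_lambda _ fun i => measurable_pi_apply _))
        · exact (measurable_toEuclideanLin _).comp (measurable_pi_apply _)
      · exact (measurable_toEuclideanLin _).comp ((measurable_pi_apply _).comp hc)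
    · intro y u hu
      have h1 := congrFun (h' y u hu) (Fin.last k)
      simp only [Model.prediction]
      rw [h y u hu, ← h1]
      rfl

/-- The residues are a measurable function of the outputs. -/
lemma exists_measurable_normalizedResidue (k : ℕ) :
    ∃ g : (Fin k → Vec m) → Fin k → Vec m, Measurable g ∧
      ∀ y u, 𝒰.IsResponse y u →
        (fun i : Fin k => M.normalizedResidue y u i) = g fun i => y i := by
  choose q hq h using exists_measurable_prediction M 𝒰
  refine ⟨fun y i => ((CFC.sqrt (M.innovCov i))⁻¹).toEuclideanLin
    (y i - M.C.toEuclideanLin (q i fun j => y (j.castLE i.2.le))), ?_, ?_⟩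
  · refine measurable_pi_lambda _ fun i => (measurable_toEuclideanLin _).comp
      ((measurable_pi_apply i).sub ((measurable_toEuclideanLin _).comp ((hq i).comp ?_)))
    exact measurable_pi_lambda _ fun j => measurable_pi_apply _
  · intro y u hu
    ext1 i
    simp only [Model.normalizedResidue]
    rw [h i y u hu]
    rfl

/-- The outputs are a measurable function of the residues. -/
lemma exists_measurable_output (k : ℕ) (hS : ∀ j < k, (M.innovCov j).PosDef) :
    ∃ g : (Fin k → Vec m) → Fin k → Vec m, Measurable g ∧
      ∀ y u, 𝒰.IsResponse y u →
        (fun i : Fin k => y i) = g fun i => M.normalizedResidue y u i := by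
  induction k with
  | zero => exact ⟨fun _ i => i.elim0, measurable_const, fun y u _ => Subsingleton.elim _ _⟩
  | succ k ih =>
    obtain ⟨g, hg, h⟩ := ih fun j hj => hS j (hj.trans k.lt_succ_self)
    obtain ⟨q, hq, h'⟩ := exists_measurable_prediction M 𝒰 k
    refine ⟨fun z => Fin.snoc (α := fun _ => Vec m) (g fun i => z i.castSucc)
      ((CFC.sqrt (M.innovCov k)).toEuclideanLin (z (Fin.last k))
        + M.C.toEuclideanLin (q (g fun i => z i.castSucc))), ?_, ?_⟩
    · have h1 : Measurable fun y : Fin (k + 1) → Vec m => g fun i => y i.castSucc :=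
        hg.comp (measurable_pi_lambda _ fun i => measurable_pi_apply _)
      exact measurable_snoc h1
        (((measurable_toEuclideanLin _).comp (measurable_pi_apply (Fin.last k))).add
          ((measurable_toEuclideanLin _).comp (hq.comp h1)))
    · intro y u hu
      ext1 i
      induction i using Fin.lastCases with
      | last =>
        -- Positive definiteness makes the square root invertible, so the normalization can be
        -- undone. The prediction to be added back involves only earlier outputs, which the
        -- induction has already recovered.
        have hp := hS k k.lt_succ_self
        have hunit : IsUnit (CFC.sqrt (M.innovCov k)) := by
          rw [CFC.isUnit_sqrt_iff _ hp.posSemidef.nonneg]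
          exact hp.isUnit
        have hdet := (Matrix.isUnit_iff_isUnit_det _).1 hunit
        have hr : (CFC.sqrt (M.innovCov k)).toEuclideanLin (M.normalizedResidue y u k)
            = y k - M.C.toEuclideanLin (M.prediction y u k) := by
          simp only [Model.normalizedResidue]
          ext1
          simp [Matrix.mulVec_mulVec, Matrix.mul_nonsing_inv _ hdet,
            Matrix.mul_nonsing_inv_cancel_left _ _ hdet]
        simp only [Fin.val_last, Fin.snoc_last, Fin.val_castSucc]
        rw [hr, ← h y u hu, ← h' y u hu, sub_add_cancel]
      | cast i => simpa using congrFun (h y u hu) i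

end Residues

/-! ### Covariance matrices of random vectors -/

section Covariance

variable {Ω : Type*} [MeasurableSpace Ω] {μ : Measure Ω} {a b c d : ℕ}

/-- `P` is the covariance matrix of the random vector `X`. -/
def HasCov (X : Ω → Vec a) (P : Matrix (Fin a) (Fin a) ℝ) (μ : Measure Ω) : Prop :=
  ∀ x y : Vec a, cov[fun ω => inner ℝ x (X ω), fun ω => inner ℝ y (X ω); μ]
    = x.ofLp ⬝ᵥ P *ᵥ y.ofLp

lemma inner_toEuclideanLin_right (F : Matrix (Fin a) (Fin b) ℝ) (x : Vec a) (y : Vec b) :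
    inner ℝ x (F.toEuclideanLin y) = inner ℝ (Fᵀ.toEuclideanLin x) y := by
  simp only [EuclideanSpace.inner_eq_star_dotProduct, star_trivial, Matrix.toLpLin_apply]
  rw [dotProduct_comm, Matrix.dotProduct_mulVec, Matrix.mulVec_transpose, dotProduct_comm]

lemma memLp_two_inner {X : Ω → Vec a} (hX : HasGaussianLaw X μ) (x : Vec a) :
    MemLp (fun ω => inner ℝ x (X ω)) 2 μ :=
  (hX.map_fun (innerSL ℝ x)).memLp_two

lemma hasCov_of_hasLaw {X : Ω → Vec a} {e : Vec a} {P : Matrix (Fin a) (Fin a) ℝ}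
    (hP : P.PosSemidef) (hX : HasLaw X (multivariateGaussian e P) μ) : HasCov X P μ := by
  intro x y
  rw [← covarianceBilin_multivariateGaussian (μ := e) hP,
    covarianceBilin_apply_eq_cov IsGaussian.memLp_two_id]
  exact hX.covariance_fun_comp (f := fun z => inner ℝ x z) (g := fun z => inner ℝ y z)
    (by fun_prop) (by fun_prop)

variable [IsProbabilityMeasure μ]

lemma HasCov.sub_const {X : Ω → Vec a} {P : Matrix (Fin a) (Fin a) ℝ} (h : HasCov X P μ)
    (hX : HasGaussianLaw X μ) (e : Vec a) : HasCov (fun ω => X ω - e) P μ := by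
  intro x y
  simp_rw [inner_sub_right]
  rw [covariance_sub_const_left ((memLp_two_inner hX x).integrable (by norm_num)),
    covariance_sub_const_right ((memLp_two_inner hX y).integrable (by norm_num)), h]

/-- Cross covariance of two linear combinations of independent Gaussian vectors. -/
lemma covariance_inner_linear {X : Ω → Vec c} {Y : Ω → Vec d} (hX : HasGaussianLaw X μ)
    (hY : HasGaussianLaw Y μ) {P : Matrix (Fin c) (Fin c) ℝ} {R : Matrix (Fin d) (Fin d) ℝ}
    (hP : HasCov X P μ) (hR : HasCov Y R μ) (hXY : IndepFun X Y μ)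
    (F : Matrix (Fin a) (Fin c) ℝ) (G : Matrix (Fin a) (Fin d) ℝ) (F' : Matrix (Fin b) (Fin c) ℝ)
    (G' : Matrix (Fin b) (Fin d) ℝ) (x : Vec a) (y : Vec b) :
    cov[fun ω => inner ℝ x (F.toEuclideanLin (X ω) + G.toEuclideanLin (Y ω)),
      fun ω => inner ℝ y (F'.toEuclideanLin (X ω) + G'.toEuclideanLin (Y ω)); μ]
      = x.ofLp ⬝ᵥ (F * P * F'ᵀ + G * R * G'ᵀ) *ᵥ y.ofLp := by
  simp_rw [inner_add_right, inner_toEuclideanLin_right]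
  have hx1 := memLp_two_inner hX (Fᵀ.toEuclideanLin x)
  have hx2 := memLp_two_inner hY (Gᵀ.toEuclideanLin x)
  have hy1 := memLp_two_inner hX (F'ᵀ.toEuclideanLin y)
  have hy2 := memLp_two_inner hY (G'ᵀ.toEuclideanLin y)
  have h1 : cov[fun ω => inner ℝ (Fᵀ.toEuclideanLin x) (X ω),
      fun ω => inner ℝ (G'ᵀ.toEuclideanLin y) (Y ω); μ] = 0 :=
    (hXY.comp (φ := fun z => inner ℝ (Fᵀ.toEuclideanLin x) z)
      (ψ := fun z => inner ℝ (G'ᵀ.toEuclideanLin y) z) (by fun_prop)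
      (by fun_prop)).covariance_eq_zero hx1 hy2
  have h2 : cov[fun ω => inner ℝ (Gᵀ.toEuclideanLin x) (Y ω),
      fun ω => inner ℝ (F'ᵀ.toEuclideanLin y) (X ω); μ] = 0 :=
    (hXY.symm.comp (φ := fun z => inner ℝ (Gᵀ.toEuclideanLin x) z)
      (ψ := fun z => inner ℝ (F'ᵀ.toEuclideanLin y) z) (by fun_prop)
      (by fun_prop)).covariance_eq_zero hx2 hy1
  have e := covariance_add_left hx1 hx2 (hy1.add hy2)
  rw [covariance_add_right hx1 hy1 hy2, covariance_add_right hx2 hy1 hy2, h1, h2, hP, hR] at e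
  refine e.trans ?_
  simp only [Matrix.toLpLin_apply, Matrix.add_mulVec, dotProduct_add, add_zero, zero_add,
    ← Matrix.mulVec_mulVec, Matrix.mulVec_transpose, Matrix.dotProduct_mulVec,
    Matrix.vecMul_vecMul]

end Covariance

/-! ### Prediction errors and innovations under normal operation -/

section Innovation

variable {n p m p' m' : ℕ} {Θ : Type*} [MeasurableSpace Θ] (M : Model n p m)

/-- The prediction error `x_k - x̂_{k|k-1}` under normal operation, as a function of the noise. -/
def predError (x₀ : Vec n) (w : ℕ → Vec n) (v : ℕ → Vec m) : ℕ → Vec n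
  | 0 => x₀ - M.xhat0
  | k + 1 => M.A.toEuclideanLin
      ((1 - M.gain (M.predCov k) * M.C).toEuclideanLin (predError x₀ w v k)
        + (-M.gain (M.predCov k)).toEuclideanLin (v k)) + w k

/-- The innovation `y_k - C x̂_{k|k-1}` under normal operation, as a function of the noise. -/
def innovation (x₀ : Vec n) (w : ℕ → Vec n) (v : ℕ → Vec m) (k : ℕ) : Vec m :=
  M.C.toEuclideanLin (predError M x₀ w v k) + v k

/-- State and prediction receive the same term `B u_k`, which cancels in the difference. The error
therefore depends on the noise alone, whatever the feedback law. -/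
lemma run_zero_x_sub_prediction (S : AttackSurface n p m p' m') (𝒰 : DefenderStrategy p m)
    (θ : Θ) (x₀ : Vec n) (w : ℕ → Vec n) (v : ℕ → Vec m) (k : ℕ) :
    (run M S 𝒰 0 θ x₀ w v k).x k
      - M.prediction (output M S 𝒰 0 θ x₀ w v) (control M S 𝒰 0 θ x₀ w v) k
      = predError M x₀ w v k := by
  induction k with
  | zero => rfl
  | succ k ih =>
    rw [run_zero_x_succ, predError, Model.prediction, ← ih, output_zero]
    apply WithLp.ofLp_injective 2
    simp only [Matrix.toLpLin_apply, Matrix.mulVec_add, Matrix.mulVec_sub, Matrix.sub_mulVec,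
      Matrix.neg_mulVec, ← Matrix.mulVec_mulVec, Matrix.one_mulVec, WithLp.ofLp_add,
      WithLp.ofLp_sub, Matrix.mulVec_neg]
    abel

lemma residue_zero (S : AttackSurface n p m p' m') (𝒰 : DefenderStrategy p m)
    (θ : Θ) (x₀ : Vec n) (w : ℕ → Vec n) (v : ℕ → Vec m) (k : ℕ) :
    residue M S 𝒰 0 θ x₀ w v k
      = ((CFC.sqrt (M.innovCov k))⁻¹).toEuclideanLin (innovation M x₀ w v k) := by
  rw [residue, Model.normalizedResidue, innovation, output_zero, ← run_zero_x_sub_prediction M S 𝒰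
    θ, map_sub M.C.toEuclideanLin]
  congr 1
  abel

/-- The prediction error and the past innovations are measurable functions of the past noise. -/
lemma exists_measurable_predError (k : ℕ) :
    ∃ g : Vec n × (Fin k → Vec n) × (Fin k → Vec m) → Vec n × (Fin k → Vec m), Measurable g ∧
      ∀ x₀ w v, (predError M x₀ w v k, fun i : Fin k => innovation M x₀ w v i)
        = g (x₀, fun i => w i, fun i => v i) := by
  induction k with
  | zero =>
    exact ⟨fun q => (q.1 - M.xhat0, fun i => i.elim0), by fun_prop,
      fun x₀ w v => Prod.ext rfl (Subsingleton.elim _ _)⟩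
  | succ k ih =>
    obtain ⟨g, hg, h⟩ := ih
    let r : Vec n × (Fin (k + 1) → Vec n) × (Fin (k + 1) → Vec m) →
      Vec n × (Fin k → Vec n) × (Fin k → Vec m) :=
      fun q => (q.1, fun i => q.2.1 i.castSucc, fun i => q.2.2 i.castSucc)
    have hr : Measurable r := by
      refine measurable_fst.prodMk (Measurable.prodMk ?_ ?_)
      · exact measurable_pi_lambda _ fun i => (measurable_pi_apply _).comp measurable_snd.fst
      · exact measurable_pi_lambda _ fun i => (measurable_pi_apply _).comp measurable_snd.snd
    have hw : Measurable fun q : Vec n × (Fin (k + 1) → Vec n) × (Fin (k + 1) → Vec m) =>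
      q.2.1 (Fin.last k) := (measurable_pi_apply _).comp measurable_snd.fst
    have hv : Measurable fun q : Vec n × (Fin (k + 1) → Vec n) × (Fin (k + 1) → Vec m) =>
      q.2.2 (Fin.last k) := (measurable_pi_apply _).comp measurable_snd.snd
    have hgr := hg.comp hr
    refine ⟨fun q => (M.A.toEuclideanLin
        ((1 - M.gain (M.predCov k) * M.C).toEuclideanLin (g (r q)).1
          + (-M.gain (M.predCov k)).toEuclideanLin (q.2.2 (Fin.last k))) + q.2.1 (Fin.last k),
        Fin.snoc (α := fun _ => Vec m) (g (r q)).2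
          (M.C.toEuclideanLin (g (r q)).1 + q.2.2 (Fin.last k))), ?_, ?_⟩
    · refine Measurable.prodMk (((measurable_toEuclideanLin _).comp
        (((measurable_toEuclideanLin _).comp hgr.fst).add
          ((measurable_toEuclideanLin _).comp hv))).add hw) ?_
      exact measurable_snoc hgr.snd (((measurable_toEuclideanLin _).comp hgr.fst).add hv)
    · intro x₀ w v
      have h' := h x₀ w v
      have e : r (x₀, fun i => w i, fun i => v i)
        = (x₀, fun i : Fin k => w i, fun i : Fin k => v i) := rfl
      simp only [e, ← h']
      refine Prod.ext rfl ?_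
      ext1 i
      induction i using Fin.lastCases with
      | last => simp [innovation]
      | cast i => simp

end Innovation

/-! ### Matrix identities of the Kalman filter -/

section Riccati

variable {n p m : ℕ} (M : Model n p m)

/-- The left side is the covariance of the filtered error `(1 - K C) E - K V` with the innovation `C
E + V`. It vanishes because the gain solves `K (C P Cᵀ + R) = P Cᵀ`. The factor `1ᵀ` is the
coefficient of `V` in the innovation, kept to match `covariance_inner_linear`. -/
lemma gain_cross_covariance {P : Matrix (Fin n) (Fin n) ℝ}
    (h : (M.C * P * M.Cᵀ + M.R).PosDef) :
    (1 - M.gain P * M.C) * P * M.Cᵀ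
      + -M.gain P * M.R * (1 : Matrix (Fin m) (Fin m) ℝ)ᵀ = 0 := by
  have hdet := (Matrix.isUnit_iff_isUnit_det _).1 h.isUnit
  have e : M.gain P * (M.C * P * M.Cᵀ + M.R) = P * M.Cᵀ := by
    rw [Model.gain, Matrix.mul_assoc _ _⁻¹, Matrix.nonsing_inv_mul _ hdet, Matrix.mul_one]
  calc _ = P * M.Cᵀ - M.gain P * (M.C * P * M.Cᵀ + M.R) := by
        simp only [Matrix.sub_mul, Matrix.one_mul, Matrix.mul_add, Matrix.transpose_one,
          Matrix.mul_one, Matrix.neg_mul, Matrix.mul_assoc]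
        abel
    _ = 0 := by rw [e, sub_self]

/-- The symmetric (Joseph) form of the posterior covariance differs from the short one by the cross
covariance with the innovation times `Kᵀ`, which is zero. -/
lemma posterior_covariance {P : Matrix (Fin n) (Fin n) ℝ}
    (h : (M.C * P * M.Cᵀ + M.R).PosDef) :
    (1 - M.gain P * M.C) * P * (1 - M.gain P * M.C)ᵀ + -M.gain P * M.R * (-M.gain P)ᵀ
      = (1 - M.gain P * M.C) * P := by
  have e := gain_cross_covariance M h
  calc _ = (1 - M.gain P * M.C) * P
        - ((1 - M.gain P * M.C) * P * M.Cᵀ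
          + -M.gain P * M.R * (1 : Matrix (Fin m) (Fin m) ℝ)ᵀ) * (M.gain P)ᵀ := by
        simp only [Matrix.sub_mul, Matrix.one_mul, Matrix.transpose_one, Matrix.add_mul,
          Matrix.transpose_sub, Matrix.transpose_mul, Matrix.transpose_neg, Matrix.mul_neg,
          Matrix.mul_sub, Matrix.mul_one, Matrix.neg_mul, Matrix.mul_assoc]
        abel
    _ = _ := by rw [e, Matrix.zero_mul, sub_zero]

lemma prediction_covariance {P : Matrix (Fin n) (Fin n) ℝ}
    (h : (M.C * P * M.Cᵀ + M.R).PosDef) :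
    M.A * ((1 - M.gain P * M.C) * P * (1 - M.gain P * M.C)ᵀ
      + -M.gain P * M.R * (-M.gain P)ᵀ) * M.Aᵀ
      + (1 : Matrix (Fin n) (Fin n) ℝ) * M.Q * (1 : Matrix (Fin n) (Fin n) ℝ)ᵀ
      = M.A * P * M.Aᵀ + M.Q - M.A * M.gain P * M.C * P * M.Aᵀ := by
  rw [posterior_covariance M h]
  simp only [Matrix.sub_mul, Matrix.one_mul, Matrix.transpose_one, Matrix.mul_sub, Matrix.mul_one,
    Matrix.mul_assoc]
  abel

end Riccati

/-! ### Independence through one filter step -/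

section Regrouping

variable {Ω α β γ δ ε ζ : Type*} [MeasurableSpace Ω] [MeasurableSpace α] [MeasurableSpace β]
  [MeasurableSpace γ] [MeasurableSpace δ] [MeasurableSpace ε] [MeasurableSpace ζ]
  {μ : Measure Ω} [IsProbabilityMeasure μ]

/-- The variables `E`, `H`, `W`, `V` are mutually independent, hence so are `H`, `W` and the pair
`(E, V)`. If that pair yields two independent functions, one may join the past `H` and the other the
fresh noise `W`. In the filter, `f` is the filtered error and `r` the innovation. -/
lemma indepFun_update {E : Ω → α} {H : Ω → β} {W : Ω → γ} {V : Ω → δ} (hE : AEMeasurable E μ)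
    (hH : AEMeasurable H μ) (hW : AEMeasurable W μ) (hV : AEMeasurable V μ)
    (hEH : IndepFun E H μ) (hWV : IndepFun W V μ)
    (h : IndepFun (fun ω => (E ω, H ω)) (fun ω => (W ω, V ω)) μ) {f : α × δ → ε} {r : α × δ → ζ}
    (hf : Measurable f) (hr : Measurable r)
    (hfr : IndepFun (fun ω => f (E ω, V ω)) (fun ω => r (E ω, V ω)) μ) :
    IndepFun (fun ω => (H ω, r (E ω, V ω))) (fun ω => (f (E ω, V ω), W ω)) μ := by
  have hfm : AEMeasurable (fun ω => f (E ω, V ω)) μ := hf.comp_aemeasurable (hE.prodMk hV)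
  have hrm : AEMeasurable (fun ω => r (E ω, V ω)) μ := hr.comp_aemeasurable (hE.prodMk hV)
  have h1 : IndepFun (fun ω => ((W ω, V ω), E ω)) H μ :=
    indepFun_prodMk_of_indepFun (hW.prodMk hV) hE hH h.symm hEH
  have h2 : IndepFun (fun ω => (E ω, V ω)) W μ := by
    refine indepFun_prodMk_of_indepFun hE hV hW ?_ hWV.symm
    exact h.comp measurable_fst measurable_swap
  have h3 : IndepFun (fun ω => (W ω, f (E ω, V ω))) (fun ω => r (E ω, V ω)) μ :=
    indepFun_prodMk_of_indepFun hW hfm hrm (h2.symm.comp measurable_id (hf.prodMk hr)) hfr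
  refine indepFun_prodMk_of_indepFun hH hrm (hfm.prodMk hW) ?_
    (h3.symm.comp measurable_id measurable_swap)
  exact h1.symm.comp (φ := id)
    (ψ := fun q : (γ × δ) × α => (r (q.2, q.1.2), (f (q.2, q.1.2), q.1.1))) measurable_id
    (by fun_prop)

end Regrouping

/-! ### One step of the Kalman filter -/

section KalmanStep

variable {n p m : ℕ} (M : Model n p m) {Ω β : Type*} [MeasurableSpace Ω] [MeasurableSpace β]
  {μ : Measure Ω} [IsProbabilityMeasure μ]

/-- The prediction error of the next step is Gaussian, its covariance follows the Riccati recursion,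
and it is independent of the past and of the current innovation. -/
lemma kalman_step {P : Matrix (Fin n) (Fin n) ℝ} (hS : (M.C * P * M.Cᵀ + M.R).PosDef)
    {E W : Ω → Vec n} {V : Ω → Vec m} {H : Ω → β} (hE : HasGaussianLaw E μ)
    (hW : HasGaussianLaw W μ) (hV : HasGaussianLaw V μ) (hH : AEMeasurable H μ)
    (hP : HasCov E P μ) (hQ : HasCov W M.Q μ) (hR : HasCov V M.R μ) (hEH : IndepFun E H μ)
    (hWV : IndepFun W V μ) (h : IndepFun (fun ω => (E ω, H ω)) (fun ω => (W ω, V ω)) μ) :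
    HasGaussianLaw (fun ω => M.A.toEuclideanLin ((1 - M.gain P * M.C).toEuclideanLin (E ω)
      + (-M.gain P).toEuclideanLin (V ω)) + W ω) μ ∧
    HasCov (fun ω => M.A.toEuclideanLin ((1 - M.gain P * M.C).toEuclideanLin (E ω)
      + (-M.gain P).toEuclideanLin (V ω)) + W ω)
      (M.A * P * M.Aᵀ + M.Q - M.A * M.gain P * M.C * P * M.Aᵀ) μ ∧
    IndepFun (fun ω => M.A.toEuclideanLin ((1 - M.gain P * M.C).toEuclideanLin (E ω)
      + (-M.gain P).toEuclideanLin (V ω)) + W ω)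
      (fun ω => (H ω, M.C.toEuclideanLin (E ω) + V ω)) μ := by
  let lin {a b : ℕ} (G : Matrix (Fin a) (Fin b) ℝ) : Vec b →L[ℝ] Vec a :=
    LinearMap.toContinuousLinearMap G.toEuclideanLin
  have one_apply {a : ℕ} (x : Vec a) : (1 : Matrix (Fin a) (Fin a) ℝ).toEuclideanLin x = x := by
    simp
  let f : Vec n × Vec m → Vec n := fun q =>
    (1 - M.gain P * M.C).toEuclideanLin q.1 + (-M.gain P).toEuclideanLin q.2
  let r : Vec n × Vec m → Vec m := fun q => M.C.toEuclideanLin q.1 + q.2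
  have hf : Measurable f :=
    ((measurable_toEuclideanLin _).comp measurable_fst).add
      ((measurable_toEuclideanLin _).comp measurable_snd)
  have hr : Measurable r := ((measurable_toEuclideanLin _).comp measurable_fst).add measurable_snd
  have hEV : IndepFun E V μ := h.comp measurable_fst measurable_snd
  have hfr_gauss : HasGaussianLaw (fun ω => (f (E ω, V ω), r (E ω, V ω))) μ :=
    (hEV.hasGaussianLaw hE hV).map_fun
      ((lin (1 - M.gain P * M.C) ∘L .fst ℝ _ _ + lin (-M.gain P) ∘L .snd ℝ _ _).prod
        (lin M.C ∘L .fst ℝ _ _ + ContinuousLinearMap.snd ℝ (Vec n) (Vec m)))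
  -- Here the choice of gain enters: the cross covariance vanishes, and joint Gaussianity turns this
  -- into independence.
  have hfr : IndepFun (fun ω => f (E ω, V ω)) (fun ω => r (E ω, V ω)) μ := by
    refine hfr_gauss.indepFun_of_covariance_inner fun x y => ?_
    have := covariance_inner_linear hE hV hP hR hEV (1 - M.gain P * M.C) (-M.gain P) M.C 1 x y
    rw [gain_cross_covariance M hS] at this
    simp only [one_apply, Matrix.zero_mulVec, dotProduct_zero] at this
    exact this
  have hall := indepFun_update hE.aemeasurable hH hW.aemeasurable hV.aemeasurable hEH hWV h hf hr hfr
  have hfW : IndepFun (fun ω => f (E ω, V ω)) W μ := by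
    have := indepFun_prodMk_of_indepFun hE.aemeasurable hV.aemeasurable hW.aemeasurable
      (h.comp measurable_fst measurable_swap) hWV.symm
    exact this.comp hf measurable_id
  refine ⟨?_, fun x y => ?_, ?_⟩
  · exact (hfW.hasGaussianLaw hfr_gauss.fst hW).map_fun 
      (lin M.A ∘L .fst ℝ _ _ + ContinuousLinearMap.snd ℝ (Vec n) (Vec n))
  -- With equal coefficients on both sides, `covariance_inner_linear` is itself a `HasCov`
  -- statement. It is used first for the filtered error and then for adding the process noise.
  · have := covariance_inner_linear hfr_gauss.fst hW
      (covariance_inner_linear hE hV hP hR hEV (1 - M.gain P * M.C) (-M.gain P) _ _) hQ hfW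
      M.A 1 M.A 1 x y
    rw [prediction_covariance M hS] at this
    simp only [one_apply] at this
    exact this
  · have hA : Measurable fun q : Vec n × Vec n => M.A.toEuclideanLin q.1 + q.2 :=
      ((measurable_toEuclideanLin _).comp measurable_fst).add measurable_snd
    exact (hall.comp measurable_id hA).symm

end KalmanStep

/-! ### Independence of the innovations -/

section Noise

variable {n p m : ℕ} {M : Model n p m} {Ω : Type*} [MeasurableSpace Ω] {μ : Measure Ω}
  {x₀ : Ω → Vec n} {w : ℕ → Ω → Vec n} {v : ℕ → Ω → Vec m}

/-- The prediction error as a random variable. -/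
def predErrorVar (M : Model n p m) (x₀ : Ω → Vec n) (w : ℕ → Ω → Vec n) (v : ℕ → Ω → Vec m)
    (k : ℕ) (ω : Ω) : Vec n :=
  predError M (x₀ ω) (fun k => w k ω) (fun k => v k ω) k

/-- The innovation as a random variable. -/
def innovationVar (M : Model n p m) (x₀ : Ω → Vec n) (w : ℕ → Ω → Vec n) (v : ℕ → Ω → Vec m)
    (k : ℕ) (ω : Ω) : Vec m :=
  innovation M (x₀ ω) (fun k => w k ω) (fun k => v k ω) k

lemma IsNoise.aemeasurable_predErrorVar (h : IsNoise M x₀ w v μ) (k : ℕ) : AEMeasurable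
    (fun ω => (predErrorVar M x₀ w v k ω, fun i : Fin k => innovationVar M x₀ w v i ω)) μ := by
  obtain ⟨g, hg, hgk⟩ := exists_measurable_predError M k
  have e : (fun ω => (predErrorVar M x₀ w v k ω, fun i : Fin k => innovationVar M x₀ w v i ω))
      = fun ω => g (x₀ ω, (fun i : Fin k => w i ω), fun i : Fin k => v i ω) :=
    funext fun ω => hgk _ _ _
  rw [e]
  exact hg.comp_aemeasurable (h.law_x₀.aemeasurable.prodMk
    ((aemeasurable_prefix (fun i => (h.law_w i).aemeasurable) k).prodMk
      (aemeasurable_prefix (fun i => (h.law_v i).aemeasurable) k)))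

lemma IsNoise.indepFun_w_v (h : IsNoise M x₀ w v μ) (k : ℕ) : IndepFun (w k) (v k) μ :=
  h.indep_w_v.comp (measurable_pi_apply k) (measurable_pi_apply k)

variable [IsProbabilityMeasure μ]

/-- Each noise sequence has its past independent of its present, and the two sequences are
independent of each other. Regrouping by time instead of by sequence separates past from present,
and the independent initial state joins the past. -/
lemma IsNoise.indepFun_past (h : IsNoise M x₀ w v μ) (k : ℕ) :
    IndepFun (fun ω => (x₀ ω, fun i : Fin k => w i ω, fun i : Fin k => v i ω))
      (fun ω => (w k ω, v k ω)) μ := by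
  have hw k : AEMeasurable (w k) μ := (h.law_w k).aemeasurable
  have hv k : AEMeasurable (v k) μ := (h.law_v k).aemeasurable
  have hwk : AEMeasurable (fun ω (i : Fin k) => w i ω) μ := aemeasurable_prefix hw k
  have hvk : AEMeasurable (fun ω (i : Fin k) => v i ω) μ := aemeasurable_prefix hv k
  have split (a : ℕ) : Measurable fun f : ℕ → Vec a => ((fun i : Fin k => f i), f k) :=
    (measurable_pi_lambda _ fun i => measurable_pi_apply _).prodMk (measurable_pi_apply k)
  have h1 := indepFun_prodMk_prodMk_of_indepFun hwk (hw k) hvk (hv k)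
    (h.indep_w_v.comp (split n) (split m)) (indepFun_prefix h.indep_w hw k)
    (indepFun_prefix h.indep_v hv k)
  refine indepFun_prodMk_of_indepFun h.law_x₀.aemeasurable (hwk.prodMk hvk)
    ((hw k).prodMk (hv k)) ?_ h1
  refine h.indep_x₀.comp (φ := id) (ψ := fun q : (ℕ → Vec n) × (ℕ → Vec m) =>
    (((fun i : Fin k => q.1 i), fun i : Fin k => q.2 i), (q.1 k, q.2 k))) measurable_id ?_
  fun_prop

lemma IsNoise.indepFun_predErrorVar (h : IsNoise M x₀ w v μ) (k : ℕ) : IndepFun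
    (fun ω => (predErrorVar M x₀ w v k ω, fun i : Fin k => innovationVar M x₀ w v i ω))
    (fun ω => (w k ω, v k ω)) μ := by
  obtain ⟨g, hg, hgk⟩ := exists_measurable_predError M k
  have e : (fun ω => (predErrorVar M x₀ w v k ω, fun i : Fin k => innovationVar M x₀ w v i ω))
      = fun ω => g (x₀ ω, (fun i : Fin k => w i ω), fun i : Fin k => v i ω) :=
    funext fun ω => hgk _ _ _
  rw [e]
  exact (h.indepFun_past k).comp hg measurable_id

/-- Under normal operation the prediction error is Gaussian with the covariance of the Kalman filter
and independent of the past innovations. -/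
lemma IsNoise.predErrorVar_law (h : IsNoise M x₀ w v μ) (k : ℕ)
    (hS : ∀ j < k, (M.innovCov j).PosDef) :
    HasGaussianLaw (predErrorVar M x₀ w v k) μ ∧
    HasCov (predErrorVar M x₀ w v k) (M.predCov k) μ ∧
    IndepFun (predErrorVar M x₀ w v k) (fun ω (i : Fin k) => innovationVar M x₀ w v i ω) μ := by
  induction k with
  | zero =>
    have hx : HasGaussianLaw x₀ μ := h.law_x₀.hasGaussianLaw
    refine ⟨?_, (hasCov_of_hasLaw M.hP0 h.law_x₀).sub_const hx M.xhat0, ?_⟩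
    · have := hx.isGaussian_map
      refine ⟨?_⟩
      have e : predErrorVar M x₀ w v 0 = (fun z => z - M.xhat0) ∘ x₀ := rfl
      rw [e, ← AEMeasurable.map_map_of_aemeasurable (by fun_prop) hx.aemeasurable]
      infer_instance
    · have e : (fun ω (i : Fin 0) => innovationVar M x₀ w v i ω) = fun _ => Fin.elim0 := by
        ext1 ω; exact Subsingleton.elim _ _
      rw [e]
      exact (indepFun_const_left _ _).symm
  | succ k ih =>
    obtain ⟨hg, hcov, hind⟩ := ih fun j hj => hS j (hj.trans k.lt_succ_self)
    obtain ⟨h1, h2, h3⟩ := kalman_step M (hS k k.lt_succ_self) hg (h.law_w k).hasGaussianLaw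
      (h.law_v k).hasGaussianLaw (h.aemeasurable_predErrorVar k).snd hcov
      (hasCov_of_hasLaw M.hQ (h.law_w k)) (hasCov_of_hasLaw M.hR (h.law_v k)) hind
      (h.indepFun_w_v k) (h.indepFun_predErrorVar k)
    refine ⟨h1, h2, ?_⟩
    have hs : Measurable fun q : (Fin k → Vec m) × Vec m =>
        Fin.snoc (α := fun _ => Vec m) q.1 q.2 := measurable_snoc measurable_fst measurable_snd
    have e : (fun ω (i : Fin (k + 1)) => innovationVar M x₀ w v i ω)
        = fun ω => Fin.snoc (α := fun _ => Vec m)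
          (fun i : Fin k => innovationVar M x₀ w v i ω) (innovationVar M x₀ w v k ω) := by
      ext1 ω
      ext1 i
      induction i using Fin.lastCases with
      | last => simp
      | cast i => simp
    rw [e]
    exact h3.comp measurable_id hs

/-- The current innovation is a function of the prediction error and the fresh noise `v k`, which
are jointly independent of the past innovations. -/
lemma IsNoise.indepFun_innovationVar (h : IsNoise M x₀ w v μ) (k : ℕ)
    (hS : ∀ j < k, (M.innovCov j).PosDef) :
    IndepFun (innovationVar M x₀ w v k) (fun ω (i : Fin k) => innovationVar M x₀ w v i ω) μ := by
  have hr : Measurable fun q : (Vec n × Vec m) × Vec n => M.C.toEuclideanLin q.2 + q.1.2 :=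
    ((measurable_toEuclideanLin M.C).comp measurable_snd).add measurable_fst.snd
  have := indepFun_prodMk_of_indepFun
    ((h.law_w k).aemeasurable.prodMk (h.law_v k).aemeasurable)
    (h.aemeasurable_predErrorVar k).fst (h.aemeasurable_predErrorVar k).snd
    (h.indepFun_predErrorVar k).symm (h.predErrorVar_law k hS).2.2
  exact this.comp hr measurable_id

end Noise

/-! ### Divergence of processes, split time by time -/

section InformationFlow

variable {Ω α : Type*} [MeasurableSpace Ω] [MeasurableSpace α] [StandardBorelSpace α] [Nonempty α]
  {μ : Measure Ω} [IsProbabilityMeasure μ]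

/-- The divergence of the laws of two processes up to time `k`, when the second has independent
values. -/
lemma klDiv_prefix_succ {X Y : ℕ → Ω → α} (hX : ∀ k, AEMeasurable (X k) μ)
    (hY : ∀ k, AEMeasurable (Y k) μ) (k : ℕ)
    (hind : IndepFun (Y k) (fun ω (i : Fin k) => Y i ω) μ) :
    klDiv (μ.map fun ω (i : Fin (k + 1)) => X i ω) (μ.map fun ω (i : Fin (k + 1)) => Y i ω)
      = klDiv (μ.map (X k)) (μ.map (Y k))
        + klDiv (μ.map fun ω (i : Fin k) => X i ω) (μ.map fun ω (i : Fin k) => Y i ω)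
        + mutualInfo (X k) (fun ω (i : Fin k) => X i ω) μ := by
  have hsplit : Measurable fun q : Fin (k + 1) → α =>
      (q (Fin.last k), fun i : Fin k => q i.castSucc) :=
    (measurable_pi_apply _).prodMk (measurable_pi_lambda _ fun i => measurable_pi_apply _)
  have hjoin : Measurable fun q : α × (Fin k → α) => Fin.snoc (α := fun _ => α) q.2 q.1 :=
    measurable_snoc measurable_snd measurable_fst
  have hsnoc (Z : ℕ → Ω → α) (ω : Ω) : (fun i : Fin (k + 1) => Z i ω)
      = Fin.snoc (α := fun _ => α) (fun i : Fin k => Z i ω) (Z k ω) := by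
    ext1 i
    induction i using Fin.lastCases with
    | last => simp
    | cast i => simp
  -- Regarding the prefix as the pair (last value, earlier values) changes no divergence. By
  -- independence the law of the second pair is a product, as the chain rule requires.
  rw [klDiv_map_of_leftInverse μ μ (aemeasurable_prefix hX (k + 1)) (aemeasurable_prefix hY (k + 1))
    (Y := fun ω => (X k ω, fun i : Fin k => X i ω)) (Y' := fun ω => (Y k ω, fun i : Fin k => Y i ω))
    hsplit hjoin (fun ω => rfl) (fun ω => rfl) (hsnoc X) (hsnoc Y),
    hind.map_prod_eq_prod_map_map (hY k) (aemeasurable_prefix hY k)]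
  have := Measure.isProbabilityMeasure_map (μ := μ) (hY k)
  have := Measure.isProbabilityMeasure_map (μ := μ) (aemeasurable_prefix hY k)
  have := Measure.isProbabilityMeasure_map (μ := μ) ((hX k).prodMk (aemeasurable_prefix hX k))
  rw [klDiv_prod_eq_mutual_add, Measure.fst_map_prodMk₀ (aemeasurable_prefix hX k),
    Measure.snd_map_prodMk₀ (hX k)]
  rfl

lemma klDiv_prefix_eq_sum {X Y : ℕ → Ω → α} (hX : ∀ k, AEMeasurable (X k) μ)
    (hY : ∀ k, AEMeasurable (Y k) μ) (K : ℕ)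
    (hind : ∀ k < K, IndepFun (Y k) (fun ω (i : Fin k) => Y i ω) μ) :
    klDiv (μ.map fun ω (i : Fin K) => X i ω) (μ.map fun ω (i : Fin K) => Y i ω)
      = ∑ k ∈ Finset.range K, klDiv (μ.map (X k)) (μ.map (Y k))
        + ∑ k ∈ Finset.range K, mutualInfo (X k) (fun ω (i : Fin k) => X i ω) μ := by
  induction K with
  | zero =>
    have e : (fun ω (i : Fin 0) => X i ω) = fun ω (i : Fin 0) => Y i ω := by
      ext1 ω; exact Subsingleton.elim _ _
    rw [e, klDiv_self]
    simp
  | succ k ih =>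
    rw [klDiv_prefix_succ hX hY k (hind k k.lt_succ_self),
      ih fun j hj => hind j (hj.trans k.lt_succ_self), Finset.sum_range_succ, Finset.sum_range_succ]
    abel

end InformationFlow

/-! ### Application to the closed loop -/

section ClosedLoop

variable {n p m p' m' : ℕ} {Θ Ω : Type*} [MeasurableSpace Θ] [MeasurableSpace Ω] {μ : Measure Ω}
  {M : Model n p m} (S : AttackSurface n p m p' m')
  (𝒰 : DefenderStrategy p m) (𝒜 : AttackStrategy S Θ) {θ : Ω → Θ}
  {x₀ : Ω → Vec n} {w : ℕ → Ω → Vec n} {v : ℕ → Ω → Vec m}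

lemma aemeasurable_output (hθ : Measurable θ) (h : IsNoise M x₀ w v μ) (k : ℕ) :
    AEMeasurable (fun ω => output M S 𝒰 𝒜 (θ ω) (x₀ ω) (fun k => w k ω) (fun k => v k ω) k) μ := by
  have hq : AEMeasurable (fun ω => (θ ω, x₀ ω, (fun k => w k ω), fun k => v k ω)) μ :=
    hθ.aemeasurable.prodMk (h.law_x₀.aemeasurable.prodMk
      ((aemeasurable_pi_lambda _ fun i => (h.law_w i).aemeasurable).prodMk
        (aemeasurable_pi_lambda _ fun i => (h.law_v i).aemeasurable)))
  have := (measurable_output M S 𝒰 𝒜 k).comp_aemeasurable hq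
  exact this.congr (.of_forall fun ω => rfl)

lemma aemeasurable_residueVar (hθ : Measurable θ) (h : IsNoise M x₀ w v μ) (k : ℕ) :
    AEMeasurable (residueVar M S 𝒰 𝒜 θ x₀ w v k) μ := by
  obtain ⟨g, hg, hgz⟩ := exists_measurable_normalizedResidue M 𝒰 (k + 1)
  have e : residueVar M S 𝒰 𝒜 θ x₀ w v k = fun ω =>
      g (fun i => output M S 𝒰 𝒜 (θ ω) (x₀ ω) (fun k => w k ω) (fun k => v k ω) i)
        (Fin.last k) := by
    ext1 ω
    exact congrFun (hgz _ _ (isResponse_control M S 𝒰 𝒜 (θ ω) (x₀ ω) _ _)) (Fin.last k)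
  rw [e]
  exact ((measurable_pi_apply _).comp hg).comp_aemeasurable
    (aemeasurable_pi_lambda _ fun i => aemeasurable_output S 𝒰 𝒜 hθ h i)

variable [IsProbabilityMeasure μ]

/-- Under normal operation each residue is independent of the earlier ones. -/
lemma indepFun_residueVar_zero (θ : Ω → Θ) (h : IsNoise M x₀ w v μ) (k : ℕ)
    (hS : ∀ j < k, (M.innovCov j).PosDef) :
    IndepFun (residueVar M S 𝒰 0 θ x₀ w v k)
      (fun ω (i : Fin k) => residueVar M S 𝒰 0 θ x₀ w v i ω) μ := by
  have e (j : ℕ) (ω : Ω) : residueVar M S 𝒰 0 θ x₀ w v j ω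
      = ((CFC.sqrt (M.innovCov j))⁻¹).toEuclideanLin (innovationVar M x₀ w v j ω) :=
    residue_zero M S 𝒰 _ _ _ _ j
  have e1 := funext (e k)
  have e2 : (fun ω (i : Fin k) => residueVar M S 𝒰 0 θ x₀ w v i ω) = _ :=
    funext fun ω => funext fun i : Fin k => e i ω
  rw [e1, e2]
  have hψ : Measurable fun (q : Fin k → Vec m) (i : Fin k) =>
      ((CFC.sqrt (M.innovCov i))⁻¹).toEuclideanLin (q i) :=
    measurable_pi_lambda _ fun i => (measurable_toEuclideanLin _).comp (measurable_pi_apply i)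
  exact (h.indepFun_innovationVar k hS).comp (measurable_toEuclideanLin _) hψ

/-- Outputs and residues carry the same divergence. -/
lemma klDiv_outputLaw_eq (hθ : Measurable θ) (h : IsNoise M x₀ w v μ) (T : ℕ)
    (hS : ∀ k ≤ T, (M.innovCov k).PosDef) :
    klDiv (outputLaw M S 𝒰 𝒜 θ x₀ w v μ T) (outputLaw M S 𝒰 0 θ x₀ w v μ T)
      = klDiv (μ.map fun ω (i : Fin (T + 1)) => residueVar M S 𝒰 𝒜 θ x₀ w v i ω)
        (μ.map fun ω (i : Fin (T + 1)) => residueVar M S 𝒰 0 θ x₀ w v i ω) := by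
  obtain ⟨g, hg, hgz⟩ := exists_measurable_normalizedResidue M 𝒰 (T + 1)
  obtain ⟨f, hf, hfy⟩ := exists_measurable_output M 𝒰 (T + 1) fun j hj => hS j (by omega)
  exact klDiv_map_of_leftInverse μ μ
    (aemeasurable_pi_lambda _ fun i => aemeasurable_output S 𝒰 𝒜 hθ h i)
    (aemeasurable_pi_lambda _ fun i => aemeasurable_output S 𝒰 0 hθ h i) hg hf
    (fun ω => hgz _ _ (isResponse_control M S 𝒰 𝒜 (θ ω) (x₀ ω) _ _))
    (fun ω => hgz _ _ (isResponse_control M S 𝒰 0 (θ ω) (x₀ ω) _ _))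
    (fun ω => hfy _ _ (isResponse_control M S 𝒰 𝒜 (θ ω) (x₀ ω) _ _))
    (fun ω => hfy _ _ (isResponse_control M S 𝒰 0 (θ ω) (x₀ ω) _ _))

end ClosedLoop

end CPS

end

theorem mainTheorem7 {n p m p' m' : ℕ} {Θ Ω : Type*} [MeasurableSpace Θ] [MeasurableSpace Ω]
    (μ : Measure Ω) [IsProbabilityMeasure μ]
    (M : CPS.Model n p m) (S : CPS.AttackSurface n p m p' m')
    (𝒰 : CPS.DefenderStrategy p m) (𝒜 : CPS.AttackStrategy S Θ)
    (θ : Ω → Θ) (hθ : Measurable θ)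
    (x₀ : Ω → CPS.Vec n) (w : ℕ → Ω → CPS.Vec n) (v : ℕ → Ω → CPS.Vec m)
    (hnoise : CPS.IsNoise M x₀ w v μ)
    (T : ℕ) (hS : ∀ k ≤ T, (M.innovCov k).PosDef) :
    (∑ k ∈ Finset.range (T + 1), CPS.residueDiv M S 𝒰 𝒜 θ x₀ w v μ k / (T + 1)
      ≤ CPS.infoFlow M S 𝒰 𝒜 θ x₀ w v μ T) ∧
    CPS.infoFlow M S 𝒰 𝒜 θ x₀ w v μ T
      = ∑ k ∈ Finset.range (T + 1), CPS.residueDiv M S 𝒰 𝒜 θ x₀ w v μ k / (T + 1)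
        + ∑ k ∈ Finset.range (T + 1),
            CPS.mutualInfo (CPS.residueVar M S 𝒰 𝒜 θ x₀ w v k)
              (fun ω (i : Fin k) => CPS.residueVar M S 𝒰 𝒜 θ x₀ w v i ω) μ / (T + 1) := by

  have key : CPS.infoFlow M S 𝒰 𝒜 θ x₀ w v μ T
      = ∑ k ∈ Finset.range (T + 1), CPS.residueDiv M S 𝒰 𝒜 θ x₀ w v μ k / (T + 1)
        + ∑ k ∈ Finset.range (T + 1),
            CPS.mutualInfo (CPS.residueVar M S 𝒰 𝒜 θ x₀ w v k)
              (fun ω (i : Fin k) => CPS.residueVar M S 𝒰 𝒜 θ x₀ w v i ω) μ / (T + 1) := by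
    rw [CPS.infoFlow, CPS.klDiv_outputLaw_eq S 𝒰 𝒜 hθ hnoise T hS,
      CPS.klDiv_prefix_eq_sum (CPS.aemeasurable_residueVar S 𝒰 𝒜 hθ hnoise)
        (CPS.aemeasurable_residueVar S 𝒰 0 hθ hnoise) (T + 1)
        fun k hk => CPS.indepFun_residueVar_zero S 𝒰 θ hnoise k fun j hj => hS j (by omega)]
    -- Division by `T + 1` is multiplication by an inverse in `ℝ≥0∞`, so it distributes over the
    -- sums without any finiteness condition.
    simp only [div_eq_mul_inv, add_mul, Finset.sum_mul]
    rfl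
  exact ⟨key ▸ le_self_add, key⟩
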